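/- **Setting.** Let $w$ be an $N\times N$ matrix-valued function, holomorphic with holomorphic inverse on $\mathbb C\setminus\{0\}$, and let $d\mu(\zeta)=w(\zeta)\,dm(\zeta)$, $dm(\zeta)=\frac{d\zeta}{2\pi i\zeta}$, be the corresponding matrix of measures on the unit circle $\mathbb T$, with moments $\hat\mu(j)=\oint_{\mathbb T}\bar\zeta^{\,j}d\mu(\zeta)$, $j\in\mathbb Z$. Assume that $\mu$ is quasi-definite: for all $n\ge 1$ the block Toeplitz matrices $(\hat\mu(r-s))_{r,s=0}^{n-1}$ and $(\hat\mu(s-r))_{r,s=0}^{n-1}$ are nonsingular. For $n\ge 0$ let $P^L_{1,n}$ and $P^R_{2,n}$ be the (unique) monic matrix polynomials of degree $n$ with $$\oint_{\mathbb T}P^L_{1,n}(\zeta)\,d\mu(\zeta)\,\bar\zeta^{\,j}=0,\qquad \oint_{\mathbb T}\big(P^R_{2,n}(\zeta)\big)^\dagger d\mu(\zeta)\,\zeta^{j}=0,\qquad 0\le j\le n-1,$$ and let $\alpha^L_{1,n}=P^L_{1,n}(0)$, $\alpha^R_{2,n}=P^R_{2,n}(0)$ be the Verblunsky matrices (so $\alpha^L_{1,0}=\alpha^R_{2,0}=I_N$).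 **Proposition.** Suppose that the right logarithmic derivative of $w$ is $$\frac{dw}{dz}(z)\,w(z)^{-1}=W_{-2}z^{-2}+W_{-1}z^{-1},\qquad z\neq 0,$$ with constant matrices $W_{-2},W_{-1}\in\mathbb C^{N\times N}$. Then the Verblunsky matrices satisfy, for all $n\ge 1$, $$-\alpha^L_{1,n}(\alpha^R_{2,n-1})^\dagger+[\alpha^L_{1,n}(\alpha^R_{2,n-1})^\dagger,W_{-1}]=\alpha^L_{1,n}W_{-2}(\alpha^R_{2,n})^\dagger-\alpha^L_{1,n-1}W_{-2}(\alpha^R_{2,n-1})^\dagger,\tag{1}$$ $$(W_{-1}+(n+1)I_N)\,\alpha^L_{1,n+1}=\alpha^L_{1,n}W_{-2},\tag{2}$$ $$(\alpha^R_{2,n-1})^\dagger(W_{-1}+(n-1)I_N)=W_{-2}(\alpha^R_{2,n})^\dagger,\tag{3}$$ $$(\alpha^R_{2,n-1})^\dagger\alpha^L_{1,n}=-W_{-2}(\alpha^R_{2,n})^\dagger\alpha^L_{1,n}+(\alpha^R_{2,n-1})^\dagger\alpha^L_{1,n-1}W_{-2}.\tag{4}$$ Suppose moreover that $W_{-2}$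 and $W_{-1}+nI_N$, for all $n\in\{1,2,\dots\}$, are nonsingular. Then for all $n\ge 1$ $$\alpha^L_{1,n}=(W_{-1}+nI_N)^{-1}\cdots(W_{-1}+2I_N)^{-1}\,\alpha^L_{1,1}\,(W_{-2})^{n-1},$$ $$(\alpha^R_{2,n})^\dagger=(W_{-2})^{-n+1}(\alpha^R_{2,1})^\dagger(W_{-1}+I_N)\cdots(W_{-1}+(n-1)I_N).\tag{5}$$ These formulas give the general solution of the linear system: two arbitrary sequences of matrices $(\alpha^L_{1,n})_{n\ge1}$ and $((\alpha^R_{2,n})^\dagger)_{n\ge 1}$ satisfy (2) for all $n\ge1$ and (1), (3), (4) for all $n\ge2$ if and only if they are of the form (5), with arbitrary first terms $\alpha^L_{1,1}$ and $(\alpha^R_{2,1})^\dagger$. Already (2) for $n\ge1$ together with (3) for $n\ge2$ is equivalent to (5), so that (1) and (4) then hold identically for $n\ge 2$. -/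

import Mathlib

open scoped ComplexConjugate Polynomial

noncomputable section

namespace MatrixSzego

/-- `N × N` complex matrices. -/
abbrev Mat (N : ℕ) : Type := Matrix (Fin N) (Fin N) ℂ

variable {N : ℕ}

/-- The entrywise integral of a matrix-valued function over the unit circle against the
normalized Lebesgue measure `dm(ζ) = dζ / (2πiζ)`. -/
def circleMean (F : ℂ → Mat N) : Mat N :=
  Matrix.of fun i j => (2 * Real.pi * Complex.I)⁻¹ * ∮ ζ in C(0, 1), ζ⁻¹ * F ζ i j

/-- The moments (Fourier coefficients) of the matrix of measures `dμ = w dm`. -/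
def moment (w : ℂ → Mat N) (j : ℤ) : Mat N :=
  circleMean fun ζ => (conj ζ) ^ j • w ζ

/-- The truncated left moment matrix; its block in position `(r, s)` is the moment of index
`r - s`. -/
def leftMomentMatrix (w : ℂ → Mat N) (n : ℕ) : Matrix (Fin n × Fin N) (Fin n × Fin N) ℂ :=
  Matrix.of fun p q => moment w ((p.1 : ℤ) - (q.1 : ℤ)) p.2 q.2

/-- The truncated right moment matrix; its block in position `(r, s)` is the moment of index
`s - r`. -/
def rightMomentMatrix (w : ℂ → Mat N) (n : ℕ) : Matrix (Fin n × Fin N) (Fin n × Fin N) ℂ :=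
  Matrix.of fun p q => moment w ((q.1 : ℤ) - (p.1 : ℤ)) p.2 q.2

/-- Quasi-definiteness of the matrix of measures `dμ = w dm`. -/
def IsQuasiDefinite (w : ℂ → Mat N) : Prop :=
  ∀ n : ℕ, 1 ≤ n → (leftMomentMatrix w n).det ≠ 0 ∧ (rightMomentMatrix w n).det ≠ 0

/-- The value at the complex number `z` of a polynomial with matrix coefficients. -/
def evalAt (P : (Mat N)[X]) (z : ℂ) : Mat N :=
  P.eval (Matrix.scalar (Fin N) z)

/-- `P` is a polynomial of degree `n` whose coefficient of `z ^ n` is the identity matrix. -/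
def IsMonicOfDegree (P : (Mat N)[X]) (n : ℕ) : Prop :=
  P.natDegree ≤ n ∧ P.coeff n = 1

/-- `P` is the left monic matrix Szegő polynomial of the first family, of degree `n`. -/
def IsSzegoL1 (w : ℂ → Mat N) (n : ℕ) (P : (Mat N)[X]) : Prop :=
  IsMonicOfDegree P n ∧
    ∀ j < n, circleMean (fun ζ => (conj ζ) ^ j • (evalAt P ζ * w ζ)) = 0

/-- `P` is the right monic matrix Szegő polynomial of the second family, of degree `n`. -/
def IsSzegoR2 (w : ℂ → Mat N) (n : ℕ) (P : (Mat N)[X]) : Prop :=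
  IsMonicOfDegree P n ∧
    ∀ j < n, circleMean (fun ζ => ζ ^ j • ((evalAt P ζ).conjTranspose * w ζ)) = 0

/-- The left Szegő polynomial of the first family. Its existence and uniqueness for
quasi-definite `w` is `existsUnique_isSzegoL1`. -/
def szegoL1 (w : ℂ → Mat N) (n : ℕ) : (Mat N)[X] :=
  Classical.epsilon (IsSzegoL1 w n)

/-- The right Szegő polynomial of the second family. Its existence and uniqueness for
quasi-definite `w` is `existsUnique_isSzegoR2`. -/
def szegoR2 (w : ℂ → Mat N) (n : ℕ) : (Mat N)[X] :=
  Classical.epsilon (IsSzegoR2 w n)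

/-- The Verblunsky matrix `α^L_{1,n} = P^L_{1,n}(0)`. -/
def verblunskyL1 (w : ℂ → Mat N) (n : ℕ) : Mat N :=
  evalAt (szegoL1 w n) 0

/-- The Verblunsky matrix `α^R_{2,n} = P^R_{2,n}(0)`. -/
def verblunskyR2 (w : ℂ → Mat N) (n : ℕ) : Mat N :=
  evalAt (szegoR2 w n) 0

/-- `w` is holomorphic, with holomorphic inverse, on the punctured plane. -/
def IsAnalyticWeight (w : ℂ → Mat N) : Prop :=
  (∀ i j, DifferentiableOn ℂ (fun z => w z i j) {0}ᶜ) ∧ ∀ z : ℂ, z ≠ 0 → IsUnit (w z)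

/-- The right logarithmic derivative `w'(z) w(z)⁻¹`. -/
def rightLogDeriv (w : ℂ → Mat N) (z : ℂ) : Mat N :=
  (Matrix.of fun i j => deriv (fun u => w u i j) z) * (w z)⁻¹

/-- First equation of the linear system, at index `n ≥ 1`; the sequence `b` stands for the
adjoints of the matrices `α^R_{2,n}`. -/
def Eq1 (Wm2 Wm1 : Mat N) (a b : ℕ → Mat N) (n : ℕ) : Prop :=
  -(a n * b (n - 1)) + ((a n * b (n - 1)) * Wm1 - Wm1 * (a n * b (n - 1)))
    = a n * Wm2 * b n - a (n - 1) * Wm2 * b (n - 1)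

/-- Second equation of the linear system. -/
def Eq2 (Wm2 Wm1 : Mat N) (a : ℕ → Mat N) (n : ℕ) : Prop :=
  (Wm1 + ((n : ℂ) + 1) • (1 : Mat N)) * a (n + 1) = a n * Wm2

/-- Third equation of the linear system, at index `n ≥ 1`. -/
def Eq3 (Wm2 Wm1 : Mat N) (b : ℕ → Mat N) (n : ℕ) : Prop :=
  b (n - 1) * (Wm1 + ((n : ℂ) - 1) • (1 : Mat N)) = Wm2 * b n

/-- Fourth equation of the linear system, at index `n ≥ 1`. -/
def Eq4 (Wm2 : Mat N) (a b : ℕ → Mat N) (n : ℕ) : Prop :=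
  b (n - 1) * a n = -(Wm2 * b n * a n) + b (n - 1) * a (n - 1) * Wm2

/-- `(W₋₁ + n I)⁻¹ (W₋₁ + (n-1) I)⁻¹ ⋯ (W₋₁ + 2 I)⁻¹ A W₋₂ ^ (n-1)`, for `n ≥ 1`. -/
def solL (Wm2 Wm1 A : Mat N) (n : ℕ) : Mat N :=
  ((List.range (n - 1)).map fun k => (Wm1 + ((n : ℂ) - (k : ℂ)) • (1 : Mat N))⁻¹).prod
    * A * Wm2 ^ (n - 1)

/-- `W₋₂ ^ (-n+1) B (W₋₁ + I) (W₋₁ + 2 I) ⋯ (W₋₁ + (n-1) I)`, for `n ≥ 1`. -/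
def solR (Wm2 Wm1 B : Mat N) (n : ℕ) : Mat N :=
  (Wm2⁻¹) ^ (n - 1) * B
    * ((List.range (n - 1)).map fun k => Wm1 + ((k : ℂ) + 1) • (1 : Mat N)).prod

/-! Existence and uniqueness of the Szegő polynomials. -/

theorem circleMean_congr {F G : ℂ → Mat N} (h : ∀ ζ : ℂ, ‖ζ‖ = 1 → F ζ = G ζ) :
    circleMean F = circleMean G := by
  ext i j
  simp only [circleMean, Matrix.of_apply]
  congr 1
  refine circleIntegral.integral_congr zero_le_one fun ζ hζ => ?_
  have : ‖ζ‖ = 1 := by simpa using hζ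
  simp only [h ζ this]

theorem circleMean_sum {w : ℂ → Mat N}
    (hw : ∀ i j, ContinuousOn (fun z => w z i j) (Metric.sphere 0 1))
    {ι : Type} (s : Finset ι) (A : ι → Mat N) (m : ι → ℤ) :
    circleMean (fun ζ => ∑ k ∈ s, (conj ζ) ^ m k • (A k * w ζ))
      = ∑ k ∈ s, A k * moment w (m k) := by
  have hc : ∀ (k : ι) (l j : Fin N),
      ContinuousOn (fun ζ : ℂ => ζ⁻¹ * ((conj ζ) ^ m k * w ζ l j)) (Metric.sphere 0 1) := by
    intro k l j
    have h0 : ∀ ζ ∈ Metric.sphere (0 : ℂ) 1, ζ ≠ 0 := by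
      rintro ζ hζ rfl
      simp at hζ
    refine ContinuousOn.mul (continuousOn_id.inv₀ h0) (ContinuousOn.mul ?_ (hw l j))
    refine ContinuousOn.zpow₀ (Complex.continuous_conj.continuousOn) _ fun ζ hζ => Or.inl ?_
    simpa using h0 ζ hζ
  have hi : ∀ (k : ι) (i l j : Fin N), CircleIntegrable
      (fun ζ : ℂ => A k i l * (ζ⁻¹ * ((conj ζ) ^ m k * w ζ l j))) 0 1 := fun k i l j =>
    ContinuousOn.circleIntegrable zero_le_one (continuousOn_const.mul (hc k l j))
  ext i j
  simp only [circleMean, moment, Matrix.of_apply, Matrix.sum_apply, Matrix.mul_apply,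
    Matrix.smul_apply, smul_eq_mul]
  have h1 : ∀ ζ : ℂ, ζ⁻¹ * ∑ k ∈ s, (conj ζ) ^ m k * ∑ l, A k i l * w ζ l j
      = ∑ k ∈ s, ∑ l, A k i l * (ζ⁻¹ * ((conj ζ) ^ m k * w ζ l j)) := by
    intro ζ
    simp only [Finset.mul_sum]
    refine Finset.sum_congr rfl fun k _ => Finset.sum_congr rfl fun l _ => by ring
  simp only [h1]
  rw [circleIntegral.integral_fun_sum (fun k _ => CircleIntegrable.fun_sum _ fun l _ => hi k i l j),
    Finset.mul_sum]
  refine Finset.sum_congr rfl fun k _ => ?_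
  rw [circleIntegral.integral_fun_sum (fun l _ => hi k i l j), Finset.mul_sum]
  refine Finset.sum_congr rfl fun l _ => ?_
  rw [circleIntegral.integral_const_mul]
  ring

theorem evalAt_eq_sum {P : (Mat N)[X]} {n : ℕ} (h : P.natDegree ≤ n) (z : ℂ) :
    evalAt P z = ∑ k ∈ Finset.range (n + 1), z ^ k • P.coeff k := by
  rw [evalAt, Polynomial.eval_eq_sum_range' (Nat.lt_succ_of_le h)]
  refine Finset.sum_congr rfl fun k _ => ?_
  rw [← map_pow, ← (Matrix.scalar_commute (z ^ k) (fun r => Commute.all _ r) (P.coeff k)).eq,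
    Matrix.scalar_apply, ← Matrix.smul_eq_diagonal_mul]

theorem conj_eq_inv {ζ : ℂ} (h : ‖ζ‖ = 1) : conj ζ = ζ⁻¹ :=
  (Complex.inv_eq_conj h).symm

theorem orthoL1_eq {w : ℂ → Mat N}
    (hw : ∀ i j, ContinuousOn (fun z => w z i j) (Metric.sphere 0 1))
    {P : (Mat N)[X]} {n : ℕ} (h : P.natDegree ≤ n) (j : ℕ) :
    circleMean (fun ζ => (conj ζ) ^ j • (evalAt P ζ * w ζ))
      = ∑ k ∈ Finset.range (n + 1), P.coeff k * moment w ((j : ℤ) - (k : ℤ)) := by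
  rw [← circleMean_sum hw]
  refine circleMean_congr fun ζ hζ => ?_
  have h0 : ζ ≠ 0 := by rintro rfl; simp at hζ
  rw [evalAt_eq_sum h, Finset.sum_mul, Finset.smul_sum]
  refine Finset.sum_congr rfl fun k _ => ?_
  rw [Matrix.smul_mul, smul_smul, conj_eq_inv hζ, zpow_sub₀ (inv_ne_zero h0)]
  congr 1
  simp

theorem orthoR2_eq {w : ℂ → Mat N}
    (hw : ∀ i j, ContinuousOn (fun z => w z i j) (Metric.sphere 0 1))
    {P : (Mat N)[X]} {n : ℕ} (h : P.natDegree ≤ n) (j : ℕ) :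
    circleMean (fun ζ => ζ ^ j • ((evalAt P ζ).conjTranspose * w ζ))
      = ∑ k ∈ Finset.range (n + 1),
          (P.coeff k).conjTranspose * moment w ((k : ℤ) - (j : ℤ)) := by
  rw [← circleMean_sum hw]
  refine circleMean_congr fun ζ hζ => ?_
  have h0 : ζ ≠ 0 := by rintro rfl; simp at hζ
  rw [evalAt_eq_sum h, Matrix.conjTranspose_sum, Finset.sum_mul, Finset.smul_sum]
  refine Finset.sum_congr rfl fun k _ => ?_
  rw [Matrix.conjTranspose_smul, Matrix.smul_mul, smul_smul, zpow_sub₀ (by simpa using h0)]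
  congr 1
  rw [star_pow, Complex.star_def, conj_eq_inv hζ]
  simp [mul_comm]

/-- A block linear system with nonsingular matrix has exactly one solution. -/
theorem existsUnique_block {n : ℕ} (f : Fin n → Fin n → Mat N)
    (hf : (Matrix.of fun p q : Fin n × Fin N => f p.1 q.1 p.2 q.2).det ≠ 0)
    (B : Fin n → Mat N) : ∃! c : Fin n → Mat N, ∀ j, ∑ k, c k * f k j = B j := by
  set T : Matrix (Fin n × Fin N) (Fin n × Fin N) ℂ :=
    Matrix.of fun p q => f p.1 q.1 p.2 q.2 with hT
  have hu : IsUnit T.det := isUnit_iff_ne_zero.mpr hf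
  let row : (Fin n → Mat N) → Matrix (Fin N) (Fin n × Fin N) ℂ :=
    fun c => Matrix.of fun i p => c p.1 i p.2
  have key : ∀ c : Fin n → Mat N, (∀ j, ∑ k, c k * f k j = B j) ↔ row c * T = row B := by
    intro c
    constructor
    · intro h
      ext i p
      rw [Matrix.mul_apply, Fintype.sum_prod_type]
      have := congrFun (congrFun (h p.1) i) p.2
      simpa [row, hT, Matrix.sum_apply, Matrix.mul_apply] using this
    · intro h j
      ext i l
      have := congrFun (congrFun h i) (j, l)
      rw [Matrix.mul_apply, Fintype.sum_prod_type] at this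
      simpa [row, hT, Matrix.sum_apply, Matrix.mul_apply] using this
  refine ⟨fun k => Matrix.of fun i l => (row B * T⁻¹) i (k, l), (key _).2 ?_, fun c hc => ?_⟩
  · have : row (fun k => Matrix.of fun i l => (row B * T⁻¹) i (k, l)) = row B * T⁻¹ := by
      ext i p
      rfl
    rw [this, Matrix.mul_assoc, Matrix.nonsing_inv_mul _ hu, Matrix.mul_one]
  · have h : row c = row B * T⁻¹ := by
      rw [← (key c).1 hc, Matrix.mul_assoc, Matrix.mul_nonsing_inv _ hu, Matrix.mul_one]
    ext k i l
    exact congrFun (congrFun h i) (k, l)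

/-- The passage from coefficients to monic polynomials. -/
theorem existsUnique_monic {n : ℕ} (Q : (Fin n → Mat N) → Prop) (h : ∃! c, Q c) :
    ∃! P : (Mat N)[X], IsMonicOfDegree P n ∧ Q fun k => P.coeff k := by
  obtain ⟨c, hc, huniq⟩ := h
  have hco : ∀ m : ℕ, (∑ k : Fin n, Polynomial.monomial (k : ℕ) (c k)).coeff m
      = if h : m < n then c ⟨m, h⟩ else 0 := by
    intro m
    simp only [Polynomial.finsetSum_coeff, Polynomial.coeff_monomial]
    split_ifs with h
    · rw [Finset.sum_eq_single ⟨m, h⟩]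
      · simp
      · intro b _ hb
        rw [if_neg]
        rintro rfl
        exact hb rfl
      · simp
    · refine Finset.sum_eq_zero fun k _ => ?_
      rw [if_neg]
      intro hk
      exact h (hk ▸ k.2)
  refine ⟨Polynomial.monomial n 1 + ∑ k : Fin n, Polynomial.monomial (k : ℕ) (c k), ?_, ?_⟩
  · refine ⟨⟨?_, ?_⟩, ?_⟩
    · refine Polynomial.natDegree_le_iff_coeff_eq_zero.mpr fun m hm => ?_
      rw [Polynomial.coeff_add, hco, Polynomial.coeff_monomial, if_neg (by omega),
        dif_neg (by omega), add_zero]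
    · rw [Polynomial.coeff_add, hco]
      simp
    · convert hc using 2 with k
      rw [Polynomial.coeff_add, hco, Polynomial.coeff_monomial, if_neg (by omega),
        dif_pos k.2, zero_add]
  · rintro P ⟨⟨hd, hm⟩, hQ⟩
    have hP := huniq _ hQ
    ext1 m
    rw [Polynomial.coeff_add, hco, Polynomial.coeff_monomial]
    rcases lt_trichotomy m n with h | h | h
    · rw [if_neg (by omega), dif_pos h, zero_add]
      exact congrFun hP ⟨m, h⟩
    · subst h
      simp [hm]
    · rw [if_neg (by omega), dif_neg (by omega), add_zero]
      exact Polynomial.natDegree_le_iff_coeff_eq_zero.mp hd m h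

theorem existsUnique_isSzegoL1 {w : ℂ → Mat N}
    (hw : ∀ i j, ContinuousOn (fun z => w z i j) (Metric.sphere 0 1))
    (hq : IsQuasiDefinite w) (n : ℕ) : ∃! P, IsSzegoL1 w n P := by
  have hdet : (rightMomentMatrix w n).det ≠ 0 := by
    rcases Nat.eq_zero_or_pos n with rfl | h
    · simp
    · exact (hq n h).2
  have h := existsUnique_monic _ (existsUnique_block
    (fun k j : Fin n => moment w ((j : ℤ) - (k : ℤ))) hdet
    fun j => -moment w ((j : ℤ) - (n : ℤ)))
  refine (existsUnique_congr fun P => ?_).mpr h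
  refine and_congr_right fun hm => ?_
  rw [Fin.forall_iff]
  refine forall₂_congr fun j hj => ?_
  rw [orthoL1_eq hw hm.1, Finset.sum_range_succ, hm.2, Matrix.one_mul, add_eq_zero_iff_eq_neg,
    Finset.sum_range]

theorem existsUnique_isSzegoR2 {w : ℂ → Mat N}
    (hw : ∀ i j, ContinuousOn (fun z => w z i j) (Metric.sphere 0 1))
    (hq : IsQuasiDefinite w) (n : ℕ) : ∃! P, IsSzegoR2 w n P := by
  have hdet : (leftMomentMatrix w n).det ≠ 0 := by
    rcases Nat.eq_zero_or_pos n with rfl | h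
    · simp
    · exact (hq n h).1
  obtain ⟨c, hc, hcu⟩ := existsUnique_block
    (fun k j : Fin n => moment w ((k : ℤ) - (j : ℤ))) hdet
    fun j => -moment w ((n : ℤ) - (j : ℤ))
  have h := existsUnique_monic (fun d : Fin n → Mat N => ∀ j : Fin n,
      ∑ k, (d k).conjTranspose * moment w ((k : ℤ) - (j : ℤ)) = -moment w ((n : ℤ) - (j : ℤ)))
    ⟨fun k => (c k).conjTranspose, fun j => by simpa using hc j, fun d hd => by
      rw [← hcu (fun k => (d k).conjTranspose) hd]
      simp⟩
  refine (existsUnique_congr fun P => ?_).mpr h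
  refine and_congr_right fun hm => ?_
  rw [Fin.forall_iff]
  refine forall₂_congr fun j hj => ?_
  rw [orthoR2_eq hw hm.1, Finset.sum_range_succ, hm.2, Matrix.conjTranspose_one, Matrix.one_mul,
    add_eq_zero_iff_eq_neg, Finset.sum_range]

theorem IsAnalyticWeight.continuousOn_sphere {w : ℂ → Mat N} (hw : IsAnalyticWeight w)
    (i j : Fin N) : ContinuousOn (fun z => w z i j) (Metric.sphere 0 1) :=
  (hw.1 i j).continuousOn.mono fun z hz => by
    rintro rfl
    simp at hz

theorem isSzegoL1_szegoL1 {w : ℂ → Mat N} (hw : IsAnalyticWeight w) (hq : IsQuasiDefinite w)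
    (n : ℕ) : IsSzegoL1 w n (szegoL1 w n) :=
  Classical.epsilon_spec (existsUnique_isSzegoL1 hw.continuousOn_sphere hq n).exists

theorem isSzegoR2_szegoR2 {w : ℂ → Mat N} (hw : IsAnalyticWeight w) (hq : IsQuasiDefinite w)
    (n : ℕ) : IsSzegoR2 w n (szegoR2 w n) :=
  Classical.epsilon_spec (existsUnique_isSzegoR2 hw.continuousOn_sphere hq n).exists

end MatrixSzego

end

open MatrixSzego

namespace MatrixSzego

variable {N : ℕ}

/-! Everything rests on equations (2) and (3). Write `P` for the left polynomial of degree `n`. The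
Pearson equation makes `z (z P w)' w⁻¹` a polynomial of degree at most `n + 1` with leading
coefficient `W₋₁ + (n+1) I`. Integration by parts shows that it satisfies the same orthogonality
relations as the left polynomial of degree `n + 1`. By quasi-definiteness it is therefore that
polynomial times `W₋₁ + (n+1) I`, and (2) is the equality of constant terms. Equation (3) follows in
the same way from the adjoint of the right polynomial, which is a polynomial in `ζ⁻¹` on the circle.

Equations (1) and (4) at index `n + 1` are algebraic consequences of (2) at `n` and (3) at `n + 1`.
Under the invertibility assumptions, (2) and (3) are two uncoupled first-order recurrences, and (5)
is their iteration.

The carrying lemmas are `moment_recurrence`, `eq2_verblunskyL1`, `eq3_verblunskyR2` and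
`eq1_of_eq2_of_eq3`, `eq4_of_eq2_of_eq3`. -/

/-! ### Quasi-definiteness as a vanishing criterion -/

/-- Uniqueness in a nonsingular block Toeplitz system: a polynomial of degree below `n` orthogonal
to the first `n` powers is zero. -/
theorem sum_moment_eq_zero {w : ℂ → Mat N} (hq : IsQuasiDefinite w) {n : ℕ} (c : ℕ → Mat N)
    (h : ∀ j < n, ∑ k ∈ Finset.range n, c k * moment w ((j : ℤ) - (k : ℤ)) = 0) :
    ∀ k < n, c k = 0 := by
  intro k hk
  have hu := existsUnique_block (fun k j : Fin n => moment w ((j : ℤ) - (k : ℤ)))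
    (hq n (by omega)).2 fun _ => 0
  have := hu.unique (y₁ := fun k : Fin n => c k) (y₂ := fun _ => 0)
    (fun j => by simpa [Finset.sum_range] using h j j.2) (fun j => by simp)
  exact congrFun this ⟨k, hk⟩

theorem sum_moment_eq_zero' {w : ℂ → Mat N} (hq : IsQuasiDefinite w) {n : ℕ} (c : ℕ → Mat N)
    (h : ∀ j < n, ∑ k ∈ Finset.range n, c k * moment w ((k : ℤ) - (j : ℤ)) = 0) :
    ∀ k < n, c k = 0 := by
  intro k hk
  have hu := existsUnique_block (fun k j : Fin n => moment w ((k : ℤ) - (j : ℤ)))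
    (hq n (by omega)).1 fun _ => 0
  have := hu.unique (y₁ := fun k : Fin n => c k) (y₂ := fun _ => 0)
    (fun j => by simpa [Finset.sum_range] using h j j.2) (fun j => by simp)
  exact congrFun this ⟨k, hk⟩

/-! ### The Pearson equation and the moments -/

/-- Replacing the conjugate by the inverse turns the integrand into a function holomorphic off zero,
so that primitives can be used. -/
theorem moment_apply (w : ℂ → Mat N) (j : ℤ) (a b : Fin N) :
    moment w j a b = (2 * Real.pi * Complex.I)⁻¹ * ∮ ζ in C(0, 1), ζ ^ (-j - 1) * w ζ a b := by
  simp only [moment, circleMean, Matrix.of_apply, Matrix.smul_apply, smul_eq_mul]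
  congr 1
  refine circleIntegral.integral_congr zero_le_one fun ζ hζ => ?_
  have h1 : ‖ζ‖ = 1 := by simpa using hζ
  have h0 : ζ ≠ 0 := by rintro rfl; simp at h1
  simp only [conj_eq_inv h1]
  rw [← mul_assoc, zpow_sub_one₀ h0, inv_zpow', mul_comm ζ⁻¹]

/-- The Pearson equation of the weight, in terms of the moments. -/
theorem moment_recurrence {w : ℂ → Mat N} {Wm2 Wm1 : Mat N} (hw : IsAnalyticWeight w)
    (hW : ∀ z : ℂ, z ≠ 0 → rightLogDeriv w z = (z ^ 2)⁻¹ • Wm2 + z⁻¹ • Wm1) (j : ℤ) :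
    Wm2 * moment w (j + 1) = (j : ℂ) • moment w j - Wm1 * moment w j := by
  have hderiv : ∀ z : ℂ, z ≠ 0 → ∀ a b, deriv (fun u => w u a b) z
      = (z ^ 2)⁻¹ * (∑ l, Wm2 a l * w z l b) + z⁻¹ * ∑ l, Wm1 a l * w z l b := by
    intro z hz a b
    have h := congrArg (· * w z) (hW z hz)
    simp only [rightLogDeriv] at h
    rw [Matrix.mul_assoc, Matrix.nonsing_inv_mul _ ((Matrix.isUnit_iff_isUnit_det _).1 (hw.2 z hz)),
      Matrix.mul_one, Matrix.add_mul, Matrix.smul_mul, Matrix.smul_mul] at h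
    have := congrFun (congrFun h a) b
    simpa only [Matrix.add_apply, Matrix.smul_apply, Matrix.mul_apply, Matrix.of_apply,
      smul_eq_mul] using this
  have hint : ∀ (m : ℤ) (c : ℂ) (a b : Fin N),
      CircleIntegrable (fun ζ : ℂ => c * (ζ ^ m * w ζ a b)) 0 1 := by
    intro m c a b
    refine ContinuousOn.circleIntegrable zero_le_one (continuousOn_const.mul
      (ContinuousOn.mul (continuousOn_id.zpow₀ _ fun ζ hζ => Or.inl ?_)
        (hw.continuousOn_sphere a b)))
    rintro rfl
    simp at hζ
  have key : ∀ a b, (∮ ζ in C(0, 1), ((∑ l, Wm2 a l * (ζ ^ (-(j + 1) - 1) * w ζ l b))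
      + ((∑ l, Wm1 a l * (ζ ^ (-j - 1) * w ζ l b))
        + (-(j : ℂ)) * (ζ ^ (-j - 1) * w ζ a b)))) = 0 := by
    intro a b
    -- By the Pearson equation the integrand is the derivative of `ζ ^ (-j) * w ζ a b`, which is
    -- single-valued on the circle.
    refine circleIntegral.integral_eq_zero_of_hasDerivWithinAt'
      (f := fun ζ : ℂ => ζ ^ (-j) * w ζ a b) fun ζ hζ => ?_
    have h0 : ζ ≠ 0 := by
      rintro rfl
      simp at hζ
    have hd : HasDerivAt (fun u => w u a b) (deriv (fun u => w u a b) ζ) ζ :=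
      ((hw.1 a b).differentiableAt (isOpen_compl_singleton.mem_nhds h0)).hasDerivAt
    refine (((hasDerivAt_zpow (-j) ζ (Or.inl h0)).mul hd).congr_deriv ?_).hasDerivWithinAt
    rw [hderiv ζ h0]
    have e1 : ζ ^ (-(j + 1) - 1) = ζ ^ (-j) * (ζ ^ 2)⁻¹ := by
      rw [show -(j + 1) - 1 = -j - 2 by ring, zpow_sub₀ h0]
      norm_cast
    have e2 : ζ ^ (-j - 1) = ζ ^ (-j) * ζ⁻¹ := zpow_sub_one₀ h0 _
    rw [e1, e2]
    simp only [Finset.mul_sum, mul_add, Int.cast_neg]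
    rw [add_comm, add_assoc]
    congr 1
    · exact Finset.sum_congr rfl fun l _ => by ring
    · congr 1
      · exact Finset.sum_congr rfl fun l _ => by ring
      · ring
  ext a b
  have h := key a b
  have hs : ∀ (M : Mat N) (m : ℤ), CircleIntegrable
      (fun ζ : ℂ => ∑ l, M a l * (ζ ^ m * w ζ l b)) 0 1 := fun M m =>
    CircleIntegrable.fun_sum _ fun l _ => hint m _ l b
  rw [circleIntegral.integral_add (hs _ _) ((hs _ _).fun_add (hint _ _ _ _)),
    circleIntegral.integral_add (hs _ _) (hint _ _ _ _),
    circleIntegral.integral_fun_sum (fun l _ => hint _ _ _ _),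
    circleIntegral.integral_fun_sum (fun l _ => hint _ _ _ _)] at h
  simp only [circleIntegral.integral_const_mul] at h
  simp only [Matrix.mul_apply, Matrix.sub_apply, Matrix.smul_apply, smul_eq_mul, moment_apply,
    mul_left_comm _ (2 * Real.pi * Complex.I : ℂ)⁻¹, ← Finset.mul_sum]
  rw [← mul_sub]
  congr 1
  linear_combination h

/-! ### Equations (2) and (3) for the Verblunsky matrices -/

theorem evalAt_zero (P : (Mat N)[X]) : evalAt P 0 = P.coeff 0 := by
  rw [evalAt, map_zero, Polynomial.coeff_zero_eq_eval_zero]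

theorem eq2_verblunskyL1 {w : ℂ → Mat N} {Wm2 Wm1 : Mat N} (hw : IsAnalyticWeight w)
    (hq : IsQuasiDefinite w)
    (hW : ∀ z : ℂ, z ≠ 0 → rightLogDeriv w z = (z ^ 2)⁻¹ • Wm2 + z⁻¹ • Wm1) (n : ℕ) :
    Eq2 Wm2 Wm1 (verblunskyL1 w) n := by
  obtain ⟨⟨hd, hm⟩, ho⟩ := isSzegoL1_szegoL1 hw hq n
  obtain ⟨⟨hd', hm'⟩, ho'⟩ := isSzegoL1_szegoL1 hw hq (n + 1)
  simp only [Eq2, verblunskyL1, evalAt_zero]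
  set P := szegoL1 w n
  set P' := szegoL1 w (n + 1)
  simp only [orthoL1_eq hw.continuousOn_sphere hd] at ho
  simp only [orthoL1_eq hw.continuousOn_sphere hd'] at ho'
  have hP : P.coeff (n + 1) = 0 := Polynomial.natDegree_le_iff_coeff_eq_zero.mp hd _ (by omega)
  let L : Mat N := Wm1 + ((n : ℂ) + 1) • (1 : Mat N)
  -- Coefficients of `z (z P)' + z P W₋₁`; the factor `z` shifts the index, hence the value 0 at 0.
  -- Adding `P W₋₂` gives `z (z P w)' w⁻¹`.
  let s : ℕ → Mat N := fun k => k.casesOn 0 fun i => P.coeff i * (Wm1 + ((i : ℂ) + 1) • 1)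
  have hs0 : s 0 = 0 := rfl
  have hs : ∀ i, s (i + 1) = P.coeff i * (Wm1 + ((i : ℂ) + 1) • 1) := fun _ => rfl
  let r : ℕ → Mat N := fun k => s k + P.coeff k * Wm2 - L * P'.coeff k
  -- `L` is chosen to cancel the top coefficient, so that `r` has degree at most `n`.
  have hr : r (n + 1) = 0 := by simp [r, hs, L, hP, hm, hm']
  have hrec := moment_recurrence hw hW
  have hz : ∀ j < n + 1, ∑ k ∈ Finset.range (n + 1), r k * moment w ((j : ℤ) - (k : ℤ)) = 0 := by
    intro j hj
    have h1 : ∑ k ∈ Finset.range (n + 2), L * P'.coeff k * moment w ((j : ℤ) - (k : ℤ)) = 0 := by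
      simp only [Matrix.mul_assoc, ← Finset.mul_sum]
      rw [ho' j hj, Matrix.mul_zero]
    -- Integration by parts, read off coefficientwise from the moment recurrence.
    have h2 : ∑ k ∈ Finset.range (n + 2), (s k + P.coeff k * Wm2) * moment w ((j : ℤ) - (k : ℤ))
        = (j : ℂ) • ∑ k ∈ Finset.range (n + 1), P.coeff k * moment w ((j : ℤ) - 1 - (k : ℤ)) := by
      simp only [Matrix.add_mul, Finset.sum_add_distrib]
      rw [Finset.sum_range_succ', 
        Finset.sum_range_succ (fun k => P.coeff k * Wm2 * moment w ((j : ℤ) - (k : ℤ))), hP]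
      simp only [hs0, hs, Matrix.zero_mul, add_zero, ← Finset.sum_add_distrib, Finset.smul_sum]
      refine Finset.sum_congr rfl fun k _ => ?_
      have := hrec ((j : ℤ) - 1 - k)
      rw [show (j : ℤ) - 1 - k + 1 = j - k by ring] at this
      rw [show (j : ℤ) - ((k + 1 : ℕ) : ℤ) = j - 1 - k by push_cast; ring, Matrix.mul_assoc,
        Matrix.mul_assoc, this, ← Matrix.mul_add, ← Matrix.mul_smul]
      congr 1
      push_cast
      rw [Matrix.add_mul, Matrix.smul_mul, Matrix.one_mul]
      module
    have h3 : (j : ℂ) • ∑ k ∈ Finset.range (n + 1), P.coeff k * moment w ((j : ℤ) - 1 - (k : ℤ))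
        = 0 := by
      -- For `j = 0` the scalar factor vanishes; otherwise orthogonality of `P` at `j - 1 < n`
      -- applies.
      rcases j with _ | i
      · simp
      · have := ho i (by omega)
        push_cast
        simp only [add_sub_cancel_right, this, smul_zero]
    have h4 : ∑ k ∈ Finset.range (n + 2), r k * moment w ((j : ℤ) - (k : ℤ)) = 0 := by
      simp only [r, Matrix.sub_mul, Finset.sum_sub_distrib]
      rw [h1, h2, h3, sub_zero]
    rwa [Finset.sum_range_succ, hr, Matrix.zero_mul, add_zero] at h4
  have h0 := sum_moment_eq_zero hq r hz 0 (by omega)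
  simp only [r, hs0, zero_add] at h0
  exact (sub_eq_zero.mp h0).symm

theorem eq3_verblunskyR2 {w : ℂ → Mat N} {Wm2 Wm1 : Mat N} (hw : IsAnalyticWeight w)
    (hq : IsQuasiDefinite w)
    (hW : ∀ z : ℂ, z ≠ 0 → rightLogDeriv w z = (z ^ 2)⁻¹ • Wm2 + z⁻¹ • Wm1) (n : ℕ) :
    Eq3 Wm2 Wm1 (fun m => (verblunskyR2 w m).conjTranspose) (n + 1) := by
  obtain ⟨⟨hd, hm⟩, ho⟩ := isSzegoR2_szegoR2 hw hq n
  obtain ⟨⟨hd', hm'⟩, ho'⟩ := isSzegoR2_szegoR2 hw hq (n + 1)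
  simp only [Eq3, verblunskyR2, evalAt_zero, Nat.add_sub_cancel]
  set P := szegoR2 w n
  set P' := szegoR2 w (n + 1)
  simp only [orthoR2_eq hw.continuousOn_sphere hd] at ho
  simp only [orthoR2_eq hw.continuousOn_sphere hd'] at ho'
  have hP : P.coeff (n + 1) = 0 := Polynomial.natDegree_le_iff_coeff_eq_zero.mp hd _ (by omega)
  let q : ℕ → Mat N := fun k => (P.coeff k).conjTranspose
  let q' : ℕ → Mat N := fun k => (P'.coeff k).conjTranspose
  have hqs : q (n + 1) = 0 := by simp [q, hP]
  let s : ℕ → Mat N := fun k => k.casesOn 0 fun i => q i * Wm2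
  have hs0 : s 0 = 0 := rfl
  have hs : ∀ i, s (i + 1) = q i * Wm2 := fun _ => rfl
  -- With `Q = ∑ q k ζ⁻ᵏ`, the first two terms are the coefficients of `ζ (Q w)' w⁻¹ + n Q`. The
  -- shift by `n` is chosen so that the missing orthogonality relation, at `j = n`, gets the factor
  -- `n - j = 0`.
  let r : ℕ → Mat N := fun k => q k * (Wm1 + ((n : ℂ) - k) • 1) + s k - Wm2 * q' k
  have hr : r (n + 1) = 0 := by simp [r, hs, hqs, q, q', hm, hm']
  have hrec := moment_recurrence hw hW
  have hz : ∀ j < n + 1, ∑ k ∈ Finset.range (n + 1), r k * moment w ((k : ℤ) - (j : ℤ)) = 0 := by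
    intro j hj
    have h1 : ∑ k ∈ Finset.range (n + 2), Wm2 * q' k * moment w ((k : ℤ) - (j : ℤ)) = 0 := by
      simp only [Matrix.mul_assoc, ← Finset.mul_sum]
      rw [ho' j hj, Matrix.mul_zero]
    have h2 : ∑ k ∈ Finset.range (n + 2),
          (q k * (Wm1 + ((n : ℂ) - k) • 1) + s k) * moment w ((k : ℤ) - (j : ℤ))
        = ((n : ℂ) - j) • ∑ k ∈ Finset.range (n + 1), q k * moment w ((k : ℤ) - (j : ℤ)) := by
      simp only [Matrix.add_mul, Finset.sum_add_distrib]
      rw [Finset.sum_range_succ' (fun k => s k * moment w ((k : ℤ) - (j : ℤ))),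
        Finset.sum_range_succ (fun k => q k * (Wm1 + ((n : ℂ) - k) • 1) * moment w ((k : ℤ) - (j : ℤ))), hqs]
      simp only [hs0, hs, Matrix.zero_mul, add_zero, ← Finset.sum_add_distrib, Finset.smul_sum]
      refine Finset.sum_congr rfl fun k _ => ?_
      have := hrec ((k : ℤ) - j)
      rw [show ((k + 1 : ℕ) : ℤ) - (j : ℤ) = k - j + 1 by push_cast; ring, Matrix.mul_assoc,
        Matrix.mul_assoc, this, ← Matrix.mul_add, ← Matrix.mul_smul]
      congr 1
      push_cast
      rw [Matrix.add_mul, Matrix.smul_mul, Matrix.one_mul]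
      module
    have h3 : ((n : ℂ) - j) • ∑ k ∈ Finset.range (n + 1), q k * moment w ((k : ℤ) - (j : ℤ))
        = 0 := by
      rcases Nat.lt_succ_iff_lt_or_eq.mp hj with h | rfl
      · rw [ho j h, smul_zero]
      · simp
    have h4 : ∑ k ∈ Finset.range (n + 2), r k * moment w ((k : ℤ) - (j : ℤ)) = 0 := by
      simp only [r, Matrix.sub_mul, Finset.sum_sub_distrib]
      rw [h1, h2, h3, sub_zero]
    rwa [Finset.sum_range_succ, hr, Matrix.zero_mul, add_zero] at h4
  have h0 := sum_moment_eq_zero' hq r hz 0 (by omega)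
  simp only [r, hs0, q, q', add_zero, Nat.cast_zero, sub_zero] at h0
  simpa using sub_eq_zero.mp h0

/-! ### Equations (1) and (4) from (2) and (3) -/

theorem eq1_of_eq2_of_eq3 {Wm2 Wm1 : Mat N} {a b : ℕ → Mat N} {n : ℕ}
    (h2 : Eq2 Wm2 Wm1 a n) (h3 : Eq3 Wm2 Wm1 b (n + 1)) : Eq1 Wm2 Wm1 a b (n + 1) := by
  simp only [Eq1, Eq2, Eq3, Nat.add_sub_cancel] at *
  rw [Matrix.mul_assoc (a (n + 1)) Wm2, ← h3, ← h2]
  push_cast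
  simp only [Matrix.add_mul, Matrix.mul_add, Matrix.smul_mul, Matrix.mul_smul, Matrix.one_mul,
    Matrix.mul_one, Matrix.mul_assoc]
  module

theorem eq4_of_eq2_of_eq3 {Wm2 Wm1 : Mat N} {a b : ℕ → Mat N} {n : ℕ}
    (h2 : Eq2 Wm2 Wm1 a n) (h3 : Eq3 Wm2 Wm1 b (n + 1)) : Eq4 Wm2 a b (n + 1) := by
  simp only [Eq4, Eq2, Eq3, Nat.add_sub_cancel] at *
  rw [Matrix.mul_assoc (b n), ← h2, ← h3]
  push_cast
  simp only [Matrix.add_mul, Matrix.mul_add, Matrix.smul_mul, Matrix.mul_smul, Matrix.one_mul,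
    Matrix.mul_one, Matrix.mul_assoc]
  module

/-! ### Solving the recurrences -/

theorem solL_one (Wm2 Wm1 A : Mat N) : solL Wm2 Wm1 A 1 = A := by simp [solL]

theorem solR_one (Wm2 Wm1 B : Mat N) : solR Wm2 Wm1 B 1 = B := by simp [solR]

theorem solL_add_two (Wm2 Wm1 A : Mat N) (n : ℕ) :
    solL Wm2 Wm1 A (n + 2)
      = (Wm1 + ((n : ℂ) + 2) • (1 : Mat N))⁻¹ * solL Wm2 Wm1 A (n + 1) * Wm2 := by
  simp only [solL, bind_pure_comp, List.map_eq_map, Nat.add_sub_cancel, show n + 2 - 1 = n + 1 by omega, List.range_succ_eq_map,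
    List.map_cons, List.prod_cons, List.map_map, pow_succ, Matrix.mul_assoc]
  -- The factors descend from the top index: the new one is the head, and the tail is the previous
  -- product reindexed.
  have : ∀ k : ℕ, ((n : ℂ) + 2) - (k + 1) = (n + 1) - k := fun k => by ring
  simp [Function.comp_def, this]

theorem solR_add_two (Wm2 Wm1 B : Mat N) (n : ℕ) :
    solR Wm2 Wm1 B (n + 2)
      = Wm2⁻¹ * solR Wm2 Wm1 B (n + 1) * (Wm1 + ((n : ℂ) + 1) • (1 : Mat N)) := by
  simp only [solR, bind_pure_comp, List.map_eq_map, Nat.add_sub_cancel, show n + 2 - 1 = n + 1 by omega, List.range_succ,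
    List.map_append, List.prod_append, pow_succ', Matrix.mul_assoc, List.map_cons, List.map_nil,
    List.prod_cons, List.prod_nil, mul_one]

theorem mul_eq_iff_eq_inv_mul {A X Y : Mat N} (hA : IsUnit A) : A * X = Y ↔ X = A⁻¹ * Y := by
  have hd := (Matrix.isUnit_iff_isUnit_det _).1 hA
  constructor
  · rintro rfl
    rw [← Matrix.mul_assoc, Matrix.nonsing_inv_mul _ hd, Matrix.one_mul]
  · rintro rfl
    rw [← Matrix.mul_assoc, Matrix.mul_nonsing_inv _ hd, Matrix.one_mul]

theorem forall_eq2_iff {Wm2 Wm1 : Mat N}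
    (h1 : ∀ n : ℕ, 1 ≤ n → IsUnit (Wm1 + (n : ℂ) • (1 : Mat N))) (a : ℕ → Mat N) :
    (∀ n : ℕ, 1 ≤ n → Eq2 Wm2 Wm1 a n) ↔ ∀ n : ℕ, 1 ≤ n → a n = solL Wm2 Wm1 (a 1) n := by
  have hstep : ∀ n : ℕ, Eq2 Wm2 Wm1 a (n + 1) ↔
      a (n + 2) = (Wm1 + ((n : ℂ) + 2) • (1 : Mat N))⁻¹ * a (n + 1) * Wm2 := by
    intro n
    have hu := h1 (n + 2) (by omega)
    have e : (((n + 1 : ℕ) : ℂ) + 1) = (n : ℂ) + 2 := by push_cast; ring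
    push_cast at hu
    rw [Eq2, e, mul_eq_iff_eq_inv_mul hu, Matrix.mul_assoc]
  constructor
  · intro h n hn
    induction n, hn using Nat.le_induction with
    | base => rw [solL_one]
    | succ m hm ih =>
      obtain ⟨k, rfl⟩ := Nat.exists_eq_add_of_le' hm
      rw [(hstep k).1 (h _ hm), solL_add_two, ih]
  · intro h n hn
    obtain ⟨k, rfl⟩ := Nat.exists_eq_add_of_le' hn
    rw [hstep, h (k + 2) (by omega), h (k + 1) hn, solL_add_two]

theorem forall_eq3_iff {Wm2 Wm1 : Mat N} (h2 : IsUnit Wm2) (b : ℕ → Mat N) :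
    (∀ n : ℕ, 2 ≤ n → Eq3 Wm2 Wm1 b n) ↔ ∀ n : ℕ, 1 ≤ n → b n = solR Wm2 Wm1 (b 1) n := by
  have hstep : ∀ n : ℕ, Eq3 Wm2 Wm1 b (n + 2) ↔
      b (n + 2) = Wm2⁻¹ * b (n + 1) * (Wm1 + ((n : ℂ) + 1) • (1 : Mat N)) := by
    intro n
    have e : (((n + 2 : ℕ) : ℂ) - 1) = (n : ℂ) + 1 := by push_cast; ring
    rw [Eq3, e, eq_comm, mul_eq_iff_eq_inv_mul h2, Matrix.mul_assoc]
    rfl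
  constructor
  · intro h n hn
    induction n, hn using Nat.le_induction with
    | base => rw [solR_one]
    | succ m hm ih =>
      obtain ⟨k, rfl⟩ := Nat.exists_eq_add_of_le' hm
      rw [(hstep k).1 (h _ (by omega)), solR_add_two, ih]
  · intro h n hn
    obtain ⟨k, rfl⟩ := Nat.exists_eq_add_of_le' hn
    rw [hstep, h (k + 2) (by omega), h (k + 1) (by omega), solR_add_two]

end MatrixSzego

theorem mainTheorem9 (N : ℕ) (w : ℂ → Mat N) (Wm2 Wm1 : Mat N)
    (hw : IsAnalyticWeight w) (hq : IsQuasiDefinite w)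
    (hW : ∀ z : ℂ, z ≠ 0 → rightLogDeriv w z = (z ^ 2)⁻¹ • Wm2 + z⁻¹ • Wm1) :
    -- the Verblunsky matrices are subject to the linear system
    (∀ n : ℕ, 1 ≤ n →
      Eq1 Wm2 Wm1 (verblunskyL1 w) (fun m => (verblunskyR2 w m).conjTranspose) n ∧
      Eq2 Wm2 Wm1 (verblunskyL1 w) n ∧
      Eq3 Wm2 Wm1 (fun m => (verblunskyR2 w m).conjTranspose) n ∧
      Eq4 Wm2 (verblunskyL1 w) (fun m => (verblunskyR2 w m).conjTranspose) n) ∧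
    (IsUnit Wm2 → (∀ n : ℕ, 1 ≤ n → IsUnit (Wm1 + (n : ℂ) • (1 : Mat N))) →
      -- the Verblunsky matrices in terms of the first ones
      (∀ n : ℕ, 1 ≤ n →
        verblunskyL1 w n = solL Wm2 Wm1 (verblunskyL1 w 1) n ∧
        (verblunskyR2 w n).conjTranspose
          = solR Wm2 Wm1 (verblunskyR2 w 1).conjTranspose n) ∧
      ∀ a b : ℕ → Mat N,
        -- the general solution of the linear system for unknowns indexed by `n ≥ 1`
        (((∀ n : ℕ, 1 ≤ n → Eq2 Wm2 Wm1 a n) ∧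
            ∀ n : ℕ, 2 ≤ n → Eq1 Wm2 Wm1 a b n ∧ Eq3 Wm2 Wm1 b n ∧ Eq4 Wm2 a b n) ↔
          ∀ n : ℕ, 1 ≤ n → a n = solL Wm2 Wm1 (a 1) n ∧ b n = solR Wm2 Wm1 (b 1) n) ∧
        -- the second and third equations suffice: the first and fourth then hold identically
        (((∀ n : ℕ, 1 ≤ n → Eq2 Wm2 Wm1 a n) ∧ ∀ n : ℕ, 2 ≤ n → Eq3 Wm2 Wm1 b n) ↔
          ∀ n : ℕ, 1 ≤ n → a n = solL Wm2 Wm1 (a 1) n ∧ b n = solR Wm2 Wm1 (b 1) n)) := by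
  have h2 := eq2_verblunskyL1 hw hq hW
  have h3 := eq3_verblunskyR2 hw hq hW
  refine ⟨fun n hn => ?_, fun hA hB => ?_⟩
  · obtain ⟨k, rfl⟩ := Nat.exists_eq_add_of_le' hn
    exact ⟨eq1_of_eq2_of_eq3 (h2 k) (h3 k), h2 _, h3 k, eq4_of_eq2_of_eq3 (h2 k) (h3 k)⟩
  · have hsol : ∀ a b : ℕ → Mat N,
        ((∀ n : ℕ, 1 ≤ n → Eq2 Wm2 Wm1 a n) ∧ ∀ n : ℕ, 2 ≤ n → Eq3 Wm2 Wm1 b n) ↔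
          ∀ n : ℕ, 1 ≤ n → a n = solL Wm2 Wm1 (a 1) n ∧ b n = solR Wm2 Wm1 (b 1) n := by
      intro a b
      rw [forall_eq2_iff hB, forall_eq3_iff hA]
      exact ⟨fun h n hn => ⟨h.1 n hn, h.2 n hn⟩,
        fun h => ⟨fun n hn => (h n hn).1, fun n hn => (h n hn).2⟩⟩
    refine ⟨(hsol _ fun m => (verblunskyR2 w m).conjTranspose).1 ⟨fun n _ => h2 n, fun n hn => ?_⟩,
      fun a b => ⟨?_, hsol a b⟩⟩
    · obtain ⟨k, rfl⟩ := Nat.exists_eq_add_of_le' hn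
      exact h3 (k + 1)
    · rw [← hsol a b]
      refine ⟨fun h => ⟨h.1, fun n hn => (h.2 n hn).2.1⟩, fun h => ⟨h.1, fun n hn => ?_⟩⟩
      obtain ⟨k, rfl⟩ := Nat.exists_eq_add_of_le' hn
      -- Index `k + 2` of (1) and (4) needs (2) at `k + 1 ≥ 1`, so the unconstrained terms `a 0` and
      -- `b 0` never enter.
      have e2 := h.1 (k + 1) (by omega)
      have e3 := h.2 (k + 2) hn
      exact ⟨eq1_of_eq2_of_eq3 e2 e3, e3, eq4_of_eq2_of_eq3 e2 e3⟩
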